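/- A \emph{pentagulation} is a finite simple plane graph in which every face (including the unbounded one) is bounded by a cycle of length $5$. For a vertex $v$ of a graph $G$ let $N_2(v)$ be the set of vertices at distance exactly $2$ from $v$. For a vertex $v$ of a plane graph $G$ let $\mathcal{F}_v$ be the subgraph of $G$ consisting of all vertices and edges that lie on the boundary of some face incident with $v$. For $x,y\in N_2(v)$, a \emph{$k$-chord with respect to $v$} is an $x$--$y$ path $Q$ of length $k$ in $G$ such that no vertex of $Q$ other than $x$ and $y$ lies in $N_2(v)$ and no edge of $Q$ is an edge of $\mathcal{F}_v$. \textbf{Theorem.} Let $G$ be a pentagulation of diameter $3$, girth $5$ and maximum degree $\Delta$, and let $v$ be a vertex of $G$ of maximum degree. If $\Delta\ge 8$, then $G$ has no $2$-chord with respect to $v$. -/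

import Mathlib

/-- A rotation system of a simple graph: for each vertex, a cyclic order of the edges at that
vertex. An edge at `x` is represented by the dart (oriented edge) that starts at `x`; the
permutation `rot` sends each dart to the next dart around its starting vertex. -/
structure RotationSystem {V : Type*} (G : SimpleGraph V) where
  rot : Equiv.Perm G.Dart
  rot_fst : ∀ d : G.Dart, (rot d).fst = d.fst
  rot_cyclic : ∀ d d' : G.Dart, d.fst = d'.fst → rot.SameCycle d d'

namespace RotationSystem

variable {V : Type*} {G : SimpleGraph V}

/-- The face-tracing permutation: having traversed the dart `d`, which ends at `d.snd`, continue
along the dart that comes after the reversal of `d` in the rotation at `d.snd`. -/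
def facePerm (R : RotationSystem G) : Equiv.Perm G.Dart :=
  (SimpleGraph.Dart.symm_involutive (G := G)).toPerm.trans R.rot

/-- The faces: the orbits of the face-tracing permutation (the facial walks). -/
def Face (R : RotationSystem G) : Type _ :=
  Quotient (Equiv.Perm.SameCycle.setoid R.facePerm)

/-- The face whose boundary is traced by the dart `d`. -/
def faceOf (R : RotationSystem G) (d : G.Dart) : R.Face :=
  Quotient.mk (Equiv.Perm.SameCycle.setoid R.facePerm) d

/-- The vertex `x` lies on the boundary of the face `f`, i.e. `f` is incident with `x`. -/
def Face.HasVertex {R : RotationSystem G} (f : R.Face) (x : V) : Prop :=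
  ∃ d : G.Dart, R.faceOf d = f ∧ d.fst = x

/-- The edge `e` lies on the boundary of the face `f`. -/
def Face.HasEdge {R : RotationSystem G} (f : R.Face) (e : Sym2 V) : Prop :=
  ∃ d : G.Dart, R.faceOf d = f ∧ d.edge = e

/-- The rotation system describes an embedding of a connected graph (with at least one edge) in
the sphere, equivalently in the plane: Euler's characteristic `|V| - |E| + |F|` is `2`. -/
def IsPlane (R : RotationSystem G) : Prop :=
  G.Connected ∧ Nat.card V + Nat.card R.Face = Nat.card G.edgeSet + 2

/-- A pentagulation: a plane graph in which every face is bounded by a cycle of length 5, i.e.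
every facial walk closes up after five steps and visits five distinct vertices. -/
def IsPentagulation (R : RotationSystem G) : Prop :=
  R.IsPlane ∧ ∀ d : G.Dart, (R.facePerm ^ 5) d = d ∧
    Function.Injective (fun i : Fin 5 => ((R.facePerm ^ (i : ℕ)) d).fst)

theorem facePerm_fst (R : RotationSystem G) (d : G.Dart) : (R.facePerm d).fst = d.snd :=
  R.rot_fst d.symm

theorem faceOf_facePerm (R : RotationSystem G) (d : G.Dart) :
    R.faceOf (R.facePerm d) = R.faceOf d :=
  Quotient.sound (Equiv.Perm.sameCycle_apply_left.2 (Equiv.Perm.SameCycle.refl _ _))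

/-- The subgraph of `G` that consists of the vertices and the edges that lie on the boundary of
a face incident with `v`. -/
def faceSubgraph (R : RotationSystem G) (v : V) : G.Subgraph where
  verts := {x | ∃ f : R.Face, f.HasVertex v ∧ f.HasVertex x}
  Adj x y := ∃ f : R.Face, f.HasVertex v ∧ f.HasEdge s(x, y)
  adj_sub := by
    rintro x y ⟨f, -, d, -, hd⟩
    have h := d.edge_mem
    rw [hd] at h
    exact h
  edge_vert := by
    rintro x y ⟨f, hv, d, hf, hd⟩
    refine ⟨f, hv, ?_⟩
    rw [SimpleGraph.dart_edge_eq_mk'_iff'] at hd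
    rcases hd with ⟨h, -⟩ | ⟨-, h⟩
    · exact ⟨d, hf, h⟩
    · exact ⟨R.facePerm d, (R.faceOf_facePerm d).trans hf, (R.facePerm_fst d).trans h⟩
  symm := ⟨by
    rintro x y ⟨f, hv, hf⟩
    exact ⟨f, hv, by rwa [Sym2.eq_swap]⟩⟩

/-- The walk `Q` from `x` to `y` is a `k`-chord with respect to `v`: it is a path of length `k`,
its ends are at distance 2 from `v`, none of its other vertices is at distance 2 from `v`, and
none of its edges lies on the boundary of a face incident with `v`. -/
def IsChord (R : RotationSystem G) (v : V) (k : ℕ) {x y : V} (Q : G.Walk x y) : Prop :=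
  Q.IsPath ∧ Q.length = k ∧ G.dist v x = 2 ∧ G.dist v y = 2 ∧
    (∀ z ∈ Q.support, z ≠ x → z ≠ y → G.dist v z ≠ 2) ∧
    ∀ e ∈ Q.edges, e ∉ (R.faceSubgraph v).edgeSet

end RotationSystem

/-! A chord end lies at distance 2 from `v`, so it is a child of some neighbour of `v`; the proof
shows that no such vertex can exist. Since the faces at `v` do provide children, more follows: with
diameter 3 and girth 5, no vertex of a pentagulation has degree 8 or more.

Planarity enters only through a discrete Jordan curve theorem. Euler's formula makes every mod 2
cycle the boundary of a set of faces, so walks that avoid `v` and join alternating pairs of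
neighbours of `v` must meet (`exists_mem_support_of_spokes_cross`). Together with the pentagonal
faces at `v`, the girth and the diameter, this is all that a `HubConfiguration` records. Spokes are
indexed by integers modulo the degree `n`, and cyclic order becomes a chain of inequalities inside a
window of length `n`.

A link between children of two spokes closes a cycle through `v`. If spokes lie strictly on both
sides, paths of length at most 3 between children on opposite sides must use this cycle, and girth 5
leaves too little room for that. Hence links join only children of equal or consecutive spokes
(`IsLink.false_of_two_le`). A path of length at most 3 between children of spokes four or more steps
apart must then run through two far vertices (`exists_far_far`). As `n ≥ 8`, there are two such
pairs in alternating position; their paths meet in a far vertex, which creates a forbidden link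
(`not_child`). -/

/-! ### Mod 2 chains and the rank of the vertex boundary map -/

namespace SimpleGraph

variable {V : Type*} {G : SimpleGraph V}

open Classical in
/-- The mod 2 boundary map of a graph, from chains of edges to chains of vertices. -/
noncomputable def boundary (G : SimpleGraph V) [Fintype G.edgeSet] :
    (G.edgeSet → ZMod 2) →ₗ[ZMod 2] (V → ZMod 2) where
  toFun c x := ∑ e : G.edgeSet, if x ∈ (e : Sym2 V) then c e else 0
  map_add' c c' := by
    ext x
    simp only [Pi.add_apply, ← Finset.sum_add_distrib]
    exact Finset.sum_congr rfl fun e _ => by split_ifs <;> simp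
  map_smul' r c := by
    ext x
    simp only [Pi.smul_apply, smul_eq_mul, RingHom.id_apply, Finset.mul_sum]
    exact Finset.sum_congr rfl fun e _ => by split_ifs <;> simp

open Classical in
/-- The mod 2 chain of the edges traversed by a walk. -/
noncomputable def Walk.chain {x y : V} (P : G.Walk x y) : G.edgeSet → ZMod 2 :=
  fun e => (P.edges.count (e : Sym2 V) : ZMod 2)

open Classical in
theorem Walk.boundary_chain [Fintype G.edgeSet] {x y : V} (P : G.Walk x y) :
    G.boundary P.chain = Pi.single x 1 + Pi.single y 1 := by
  induction P with
  | nil =>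
    ext z
    simp only [boundary, Walk.chain, LinearMap.coe_mk, AddHom.coe_mk, Walk.edges_nil,
      List.count_nil, Pi.add_apply]
    simp [CharTwo.add_self_eq_zero]
  | @cons u w y h P ih =>
    have hc : (Walk.cons h P).chain
        = Pi.single (⟨s(u, w), h⟩ : G.edgeSet) 1 + P.chain := by
      ext e
      simp only [Walk.chain, Walk.edges_cons, List.count_cons, Pi.add_apply, Pi.single_apply]
      by_cases he : s(u, w) = (e : Sym2 V)
      · have : e = ⟨s(u, w), h⟩ := Subtype.ext he.symm
        simp [this, add_comm]
      · have : e ≠ ⟨s(u, w), h⟩ := fun h' => he (by rw [h'])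
        simp [this, he]
    have hs : G.boundary (Pi.single (⟨s(u, w), h⟩ : G.edgeSet) 1)
        = Pi.single u 1 + Pi.single w 1 := by
      ext z
      have hne := h.ne
      simp only [boundary, LinearMap.coe_mk, AddHom.coe_mk, Pi.add_apply]
      rw [Finset.sum_eq_single (⟨s(u, w), h⟩ : G.edgeSet)]
      · simp only [Sym2.mem_iff, Pi.single_apply]
        by_cases h1 : z = u
        · subst h1; simp [hne]
        · simp [h1]
      · intro e _ he
        simp [he]
      · simp
    rw [hc, map_add, ih, hs]
    ext z
    simp only [Pi.add_apply]
    have := CharTwo.add_self_eq_zero ((Pi.single w 1 : V → ZMod 2) z)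
    linear_combination this

/-- A walk from `x` to a fixed `u` has boundary `x + u`, so the boundaries together with the single
vector at `u` span all vertex chains. -/
theorem Connected.card_le_finrank_range_boundary [Fintype V] [Fintype G.edgeSet]
    (hG : G.Connected) :
    Nat.card V ≤ Module.finrank (ZMod 2) (LinearMap.range G.boundary) + 1 := by
  classical
  obtain ⟨u⟩ := hG.nonempty
  have htop : LinearMap.range G.boundary ⊔ Submodule.span (ZMod 2) {(Pi.single u 1 : V → ZMod 2)}
      = ⊤ := by
    rw [eq_top_iff, ← (Pi.basisFun (ZMod 2) V).span_eq, Submodule.span_le]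
    rintro _ ⟨x, rfl⟩
    obtain ⟨P⟩ := hG.preconnected x u
    have h1 : (Pi.single x 1 : V → ZMod 2) = G.boundary P.chain + Pi.single u 1 := by
      rw [P.boundary_chain]
      ext z
      simp only [Pi.add_apply]
      have := CharTwo.add_self_eq_zero ((Pi.single u 1 : V → ZMod 2) z)
      linear_combination -this
    rw [Pi.basisFun_apply, h1]
    exact Submodule.add_mem_sup ⟨_, rfl⟩ (Submodule.mem_span_singleton_self _)
  have h2 := Submodule.finrank_add_le_finrank_add_finrank (LinearMap.range G.boundary)
    (Submodule.span (ZMod 2) {(Pi.single u 1 : V → ZMod 2)})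
  rw [htop, finrank_top, Module.finrank_fintype_fun_eq_card] at h2
  have h3 := finrank_span_le_card (R := ZMod 2) ({(Pi.single u 1 : V → ZMod 2)} : Set (V → ZMod 2))
  simp only [Set.toFinset_singleton, Finset.card_singleton] at h3
  rw [Nat.card_eq_fintype_card]
  omega

end SimpleGraph

/-! ### Face boundaries and mod 2 cycles -/

namespace RotationSystem

variable {V : Type*} {G : SimpleGraph V} (R : RotationSystem G)

theorem faceOf_rot (d : G.Dart) : R.faceOf (R.rot d) = R.faceOf d.symm := by
  have h := R.faceOf_facePerm d.symm
  rwa [facePerm, Equiv.trans_apply, Function.Involutive.coe_toPerm,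
    SimpleGraph.Dart.symm_symm] at h

instance [Finite V] : Finite R.Face :=
  haveI : Finite G.Dart := Finite.of_injective _ SimpleGraph.Dart.toProd_injective
  inferInstanceAs (Finite (Quotient _))

theorem rot_zpow_fst (i : ℤ) (d : G.Dart) : ((R.rot ^ i) d).fst = d.fst := by
  induction i with
  | zero => simp
  | succ i ih => rw [add_comm, zpow_add, zpow_one, Equiv.Perm.mul_apply, R.rot_fst, ih]
  | pred i ih =>
    rw [← ih, ← R.rot_fst, ← Equiv.Perm.mul_apply, ← zpow_one_add]
    congr 4
    ring

/-- The rotation is transitive on the darts at `x`, so invariance under one step suffices. -/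
theorem eq_of_fst_eq {α : Type*} (ψ : G.Dart → α) {x : V}
    (hψ : ∀ d : G.Dart, d.fst = x → ψ (R.rot d) = ψ d) {d d' : G.Dart}
    (h : d.fst = x) (h' : d'.fst = x) : ψ d = ψ d' := by
  obtain ⟨i, rfl⟩ := R.rot_cyclic d d' (h.trans h'.symm)
  clear h'
  induction i with
  | zero => simp
  | succ i ih =>
    rw [add_comm, zpow_add, zpow_one, Equiv.Perm.mul_apply, hψ _ ((R.rot_zpow_fst _ _).trans h), ih]
  | pred i ih =>
    rw [ih, ← hψ ((R.rot ^ (-(i : ℤ) - 1)) d) ((R.rot_zpow_fst _ _).trans h),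
      ← Equiv.Perm.mul_apply, ← zpow_one_add]
    congr 3
    ring

open Classical in
/-- The mod 2 boundary map from chains of faces to chains of edges. -/
noncomputable def faceBoundary [Fintype G.Dart] :
    (R.Face → ZMod 2) →ₗ[ZMod 2] (G.edgeSet → ZMod 2) where
  toFun f e := ∑ d : G.Dart, if d.edge = e then f (R.faceOf d) else 0
  map_add' c c' := by
    ext x
    simp only [Pi.add_apply, ← Finset.sum_add_distrib]
    exact Finset.sum_congr rfl fun e _ => by split_ifs <;> simp
  map_smul' r c := by
    ext x
    simp only [Pi.smul_apply, smul_eq_mul, RingHom.id_apply, Finset.mul_sum]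
    exact Finset.sum_congr rfl fun e _ => by split_ifs <;> simp

theorem faceBoundary_apply [Fintype G.Dart] (f : R.Face → ZMod 2) (d : G.Dart) :
    R.faceBoundary f ⟨d.edge, d.edge_mem⟩ = f (R.faceOf d) + f (R.faceOf d.symm) := by
  classical
  simp only [faceBoundary, LinearMap.coe_mk, AddHom.coe_mk, SimpleGraph.dart_edge_eq_iff]
  rw [← Finset.sum_filter]
  have : (Finset.univ.filter fun d' : G.Dart => d' = d ∨ d' = d.symm) = {d, d.symm} := by
    ext; simp
  rw [this, Finset.sum_pair d.symm_ne.symm]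

/-- A facial walk leaves each vertex as often as it enters it: reindexing by `facePerm` turns the
sum over darts ending at `x` into the sum over darts starting there, and the two cancel mod 2. -/
theorem boundary_faceBoundary [Fintype G.Dart] [Fintype G.edgeSet] (f : R.Face → ZMod 2) :
    G.boundary (R.faceBoundary f) = 0 := by
  classical
  ext x
  have h1 : G.boundary (R.faceBoundary f) x
      = ∑ d : G.Dart, if x ∈ d.edge then f (R.faceOf d) else 0 := by
    simp only [SimpleGraph.boundary, faceBoundary, LinearMap.coe_mk, AddHom.coe_mk]
    have h2 : ∀ e : G.edgeSet, (if x ∈ (e : Sym2 V) then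
        ∑ d : G.Dart, (if d.edge = e then f (R.faceOf d) else 0) else 0)
        = ∑ d : G.Dart, if d.edge = e then (if x ∈ d.edge then f (R.faceOf d) else 0) else 0 := by
      intro e
      split_ifs with hx
      · refine Finset.sum_congr rfl fun d _ => ?_
        by_cases hd : d.edge = e
        · simp [hd, hx]
        · simp [hd]
      · symm
        refine Finset.sum_eq_zero fun d _ => ?_
        by_cases hd : d.edge = e
        · simp [hd, hx]
        · simp [hd]
    rw [Finset.sum_congr rfl fun e _ => h2 e, Finset.sum_comm]
    refine Finset.sum_congr rfl fun d _ => ?_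
    rw [Finset.sum_eq_single (⟨d.edge, d.edge_mem⟩ : G.edgeSet)]
    · simp
    · intro e _ he
      rw [if_neg]
      exact fun h => he (Subtype.ext h.symm)
    · simp
  have h2 : ∀ d : G.Dart, (if x ∈ d.edge then f (R.faceOf d) else 0)
      = (if d.fst = x then f (R.faceOf d) else 0)
        + (if (R.facePerm d).fst = x then f (R.faceOf (R.facePerm d)) else 0) := by
    intro d
    rw [R.facePerm_fst, R.faceOf_facePerm]
    have hm : x ∈ d.edge ↔ d.fst = x ∨ d.snd = x := by
      rw [SimpleGraph.Dart.edge]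
      simp [eq_comm]
    have hne := d.adj.ne
    by_cases h3 : d.fst = x
    · have h4 : d.snd ≠ x := fun h => hne (h3.trans h.symm)
      simp [hm, h3, h4]
    · simp [hm, h3]
  rw [h1, Finset.sum_congr rfl fun d _ => h2 d, Finset.sum_add_distrib,
    Equiv.sum_comp R.facePerm (fun d => if d.fst = x then f (R.faceOf d) else 0),
    CharTwo.add_self_eq_zero]
  rfl

/-- A face chain with zero boundary agrees on both sides of every edge, hence all around every
vertex, hence everywhere by connectedness. -/
theorem finrank_ker_faceBoundary_le [Fintype V] [Fintype G.Dart] (hG : G.Connected) :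
    Module.finrank (ZMod 2) (LinearMap.ker R.faceBoundary) ≤ 1 := by
  classical
  refine finrank_le_one (⟨fun _ => 1, ?_⟩ : LinearMap.ker R.faceBoundary) ?_
  · rw [LinearMap.mem_ker]
    ext ⟨e, he⟩
    induction e with | _ a b
    exact (R.faceBoundary_apply (fun _ => 1) ⟨(a, b), he⟩).trans (CharTwo.add_self_eq_zero _)
  · rintro ⟨f, hf⟩
    rw [LinearMap.mem_ker] at hf
    have hsymm : ∀ d : G.Dart, f (R.faceOf d.symm) = f (R.faceOf d) := by
      intro d
      have h := R.faceBoundary_apply f d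
      rw [hf, Pi.zero_apply, eq_comm, CharTwo.add_eq_zero] at h
      exact h.symm
    have hfst : ∀ d d' : G.Dart, d.fst = d'.fst → f (R.faceOf d) = f (R.faceOf d') :=
      fun d d' h => R.eq_of_fst_eq (fun d => f (R.faceOf d))
        (fun d _ => by rw [R.faceOf_rot, hsymm]) h rfl
    have hw : ∀ {x y : V} (P : G.Walk x y) (d d' : G.Dart), d.fst = x → d'.fst = y →
        f (R.faceOf d) = f (R.faceOf d') := by
      intro x y P
      induction P with
      | nil => intro d d' h h'; exact hfst _ _ (h.trans h'.symm)
      | @cons u w y h P ih =>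
        intro d d' hd hd'
        rw [hfst d ⟨(u, w), h⟩ hd, ← hsymm]
        exact ih _ _ rfl hd'
    by_cases hne : Nonempty G.Dart
    · obtain ⟨d⟩ := hne
      refine ⟨f (R.faceOf d), Subtype.ext ?_⟩
      funext φ
      induction φ using Quotient.inductionOn with | _ d'
      obtain ⟨P⟩ := hG.preconnected d.fst d'.fst
      exact (mul_one _).trans (hw P d d' rfl rfl)
    · refine ⟨0, Subtype.ext ?_⟩
      funext φ
      induction φ using Quotient.inductionOn with | _ d'
      exact absurd ⟨d'⟩ hne

/-- In a plane graph, every mod 2 cycle is the boundary of a set of faces. -/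
theorem IsPlane.exists_faceBoundary_eq [Fintype V] [Fintype G.Dart] [Fintype G.edgeSet]
    {R : RotationSystem G} (hR : R.IsPlane)
    {c : G.edgeSet → ZMod 2} (hc : G.boundary c = 0) : ∃ f, R.faceBoundary f = c := by
  classical
  have : Fintype R.Face := Fintype.ofFinite _
  have hle : LinearMap.range R.faceBoundary ≤ LinearMap.ker G.boundary := by
    rintro _ ⟨f, rfl⟩
    exact R.boundary_faceBoundary f
  have h1 := hR.1.card_le_finrank_range_boundary
  have h2 := R.finrank_ker_faceBoundary_le hR.1
  have h3 := LinearMap.finrank_range_add_finrank_ker G.boundary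
  have h4 := LinearMap.finrank_range_add_finrank_ker R.faceBoundary
  have h5 := hR.2
  rw [Module.finrank_fintype_fun_eq_card, ← Nat.card_eq_fintype_card] at h3 h4
  -- `|F| - 1 ≤ rank faceBoundary ≤ dim ker boundary ≤ |E| - |V| + 1`, and Euler's formula makes the
  -- two ends equal.
  have heq := Submodule.eq_of_le_of_finrank_le hle (by omega)
  have hm : c ∈ LinearMap.ker G.boundary := hc
  rwa [← heq] at hm

end RotationSystem

/-! ### Spokes at a vertex and the crossing of walks -/

namespace RotationSystem

variable {V : Type*} {G : SimpleGraph V} (R : RotationSystem G)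

/-- The neighbours of the starting vertex of `d`, in the order of the rotation, starting with the
end of `d`. -/
def spoke (d : G.Dart) (i : ℤ) : V := ((R.rot ^ i) d).snd

theorem adj_spoke (d : G.Dart) (i : ℤ) : G.Adj d.fst (R.spoke d i) := by
  have h := ((R.rot ^ i) d).adj
  rwa [R.rot_zpow_fst] at h

theorem exists_spoke_eq (d : G.Dart) {u : V} (h : G.Adj d.fst u) : ∃ i, R.spoke d i = u := by
  obtain ⟨i, hi⟩ := R.rot_cyclic d ⟨(d.fst, u), h⟩ rfl
  exact ⟨i, by rw [spoke, hi]⟩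

/-- The orbit of `d` under the rotation is the set of all darts at its start, so its period is the
degree. -/
theorem spoke_eq_spoke_iff [Fintype V] [DecidableRel G.Adj] (d : G.Dart) (i j : ℤ) :
    R.spoke d i = R.spoke d j ↔ (G.degree d.fst : ℤ) ∣ i - j := by
  classical
  have h1 : R.spoke d i = R.spoke d j ↔ (R.rot ^ i) d = (R.rot ^ j) d := by
    refine ⟨fun h => ?_, fun h => by rw [spoke, spoke, h]⟩
    exact SimpleGraph.Dart.ext _ _ (Prod.ext
      ((R.rot_zpow_fst i d).trans (R.rot_zpow_fst j d).symm) h)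
  have h2 : (R.rot ^ i) d = (R.rot ^ j) d ↔ R.rot ^ (i - j) • d = d := by
    rw [sub_eq_neg_add, zpow_add, zpow_neg, mul_smul, inv_smul_eq_iff]
    rfl
  have horb : MulAction.orbit (Subgroup.zpowers R.rot) d = {d' : G.Dart | d'.fst = d.fst} := by
    ext d'
    constructor
    · rintro ⟨⟨_, ⟨i, rfl⟩⟩, rfl⟩
      exact R.rot_zpow_fst i d
    · intro h
      obtain ⟨i, hi⟩ := R.rot_cyclic d d' (Eq.symm h)
      exact ⟨⟨R.rot ^ i, i, rfl⟩, hi⟩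
  have h3 : Function.minimalPeriod (R.rot • ·) d = G.degree d.fst := by
    rw [← Nat.card_zmod (Function.minimalPeriod (R.rot • ·) d),
      ← Nat.card_congr (MulAction.orbitZPowersEquiv R.rot d), horb,
      ← G.dart_fst_fiber_card_eq_degree, ← Nat.card_eq_finsetCard]
    exact Nat.card_congr (Equiv.subtypeEquivRight fun d' => by simp)
  rw [h1, h2, MulAction.zpow_smul_eq_iff_minimalPeriod_dvd, h3]

/-- `P` and the spokes `i`, `k` form a closed walk `W`. It bounds a mod 2 set of faces, which acts
as its inside. A walk `Q` disjoint from `W` stays on one side, whereas turning around the hub from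
`j` to `l` changes side exactly once. -/
theorem IsPlane.exists_mem_support_of_spokes_cross [Fintype V] [DecidableRel G.Adj]
    {R : RotationSystem G} (hR : R.IsPlane) (d : G.Dart) {i j k l : ℤ} (hij : i < j) (hjk : j < k)
    (hkl : k < l) (hli : l < i + G.degree d.fst)
    (P : G.Walk (R.spoke d i) (R.spoke d k)) (hP : d.fst ∉ P.support)
    (Q : G.Walk (R.spoke d j) (R.spoke d l)) (hQ : d.fst ∉ Q.support) :
    ∃ z ∈ P.support, z ∈ Q.support := by
  classical
  by_contra! hdisj
  have hne : ∀ a b : ℤ, a < b → b < a + G.degree d.fst → R.spoke d a ≠ R.spoke d b := by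
    intro a b hab hba h
    rw [eq_comm, R.spoke_eq_spoke_iff] at h
    have := Int.le_of_dvd (by omega) h
    omega
  let W : G.Walk d.fst d.fst :=
    .cons (R.adj_spoke d i) (P.append (.cons (R.adj_spoke d k).symm .nil))
  have hWe : W.edges = s(d.fst, R.spoke d i) :: (P.edges ++ [s(R.spoke d k, d.fst)]) := by
    simp [W]
  obtain ⟨f, hf⟩ := hR.exists_faceBoundary_eq (c := W.chain)
    (by rw [W.boundary_chain]; ext z; exact CharTwo.add_self_eq_zero _)
  have hφ : ∀ e : G.Dart, f (R.faceOf e.symm) = f (R.faceOf e) + (W.edges.count e.edge : ZMod 2) := by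
    intro e
    have h := R.faceBoundary_apply f e
    rw [hf] at h
    have h' : (W.edges.count e.edge : ZMod 2) = _ := h
    rw [h', ← add_assoc, CharTwo.add_self_eq_zero, zero_add]
  have hoff : ∀ e : G.Dart, e.fst ≠ d.fst → e.fst ∉ P.support →
      f (R.faceOf e.symm) = f (R.faceOf e) := by
    intro e h1 h2
    have h0 : e.edge ∉ W.edges := by
      rw [hWe]
      simp only [List.mem_cons, List.mem_append, List.not_mem_nil, or_false, not_or]
      refine ⟨fun h => ?_, fun h => h2 (P.fst_mem_support_of_mem_edges h), fun h => ?_⟩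
      · rcases SimpleGraph.dart_edge_eq_mk'_iff'.1 h with h | h
        · exact h1 h.1
        · exact h2 (by rw [h.1]; exact P.start_mem_support)
      · rcases SimpleGraph.dart_edge_eq_mk'_iff'.1 h with h | h
        · exact h2 (by rw [h.1]; exact P.end_mem_support)
        · exact h1 h.1
    rw [hφ, List.count_eq_zero_of_not_mem h0, Nat.cast_zero, add_zero]
  have hside : ∀ {x y : V} (Q : G.Walk x y), d.fst ∉ Q.support →
      (∀ z ∈ P.support, z ∉ Q.support) → ∀ e e' : G.Dart, e.fst = x → e'.fst = y →
      f (R.faceOf e) = f (R.faceOf e') := by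
    intro x y Q
    have hloc : ∀ x, x ≠ d.fst → x ∉ P.support → ∀ e e' : G.Dart, e.fst = x → e'.fst = x →
        f (R.faceOf e) = f (R.faceOf e') := fun x h1 h2 e e' he he' =>
      R.eq_of_fst_eq (fun e => f (R.faceOf e))
        (fun e he => by rw [R.faceOf_rot, hoff e (he ▸ h1) (he ▸ h2)]) he he'
    induction Q with
    | @nil x =>
      intro h1 h2 e e' he he'
      exact hloc x (fun h => h1 (by simp [h])) (fun h => h2 x h (by simp)) e e' he he'
    | @cons x u y h Q ih =>
      intro h1 h2 e e' he he'
      rw [SimpleGraph.Walk.support_cons, List.mem_cons, not_or] at h1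
      have hx : x ∉ P.support := fun h => h2 x h (by simp)
      rw [hloc x (Ne.symm h1.1) hx e ⟨(x, u), h⟩ he rfl, ← hoff _ (Ne.symm h1.1) hx]
      exact ih h1.2 (fun z hz hz' => h2 z hz (by simp [hz'])) _ _ rfl he'
  -- Passing from the face of one spoke to that of the next crosses spoke `m`. Since `P` avoids the
  -- hub, `W` uses only the spokes `i` and `k` there.
  have hstep : ∀ m : ℤ, f (R.faceOf ((R.rot ^ (m + 1)) d)) = f (R.faceOf ((R.rot ^ m) d))
      + ((if R.spoke d m = R.spoke d i then 1 else 0)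
        + if R.spoke d m = R.spoke d k then 1 else 0) := by
    intro m
    have hedge : ((R.rot ^ m) d).edge = s(d.fst, R.spoke d m) := by
      rw [SimpleGraph.dart_edge_eq_mk'_iff']
      exact Or.inl ⟨R.rot_zpow_fst m d, rfl⟩
    have hPe : s(d.fst, R.spoke d m) ∉ P.edges := fun h => hP (P.fst_mem_support_of_mem_edges h)
    have hne' : ∀ j, d.fst ≠ R.spoke d j := fun j => (R.adj_spoke d j).ne
    rw [add_comm m 1, zpow_one_add, Equiv.Perm.mul_apply, R.faceOf_rot, hφ, hWe, hedge,
      List.count_cons, List.count_append, List.count_eq_zero_of_not_mem hPe]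
    have e1 : (s(d.fst, R.spoke d i) == s(d.fst, R.spoke d m))
        = decide (R.spoke d m = R.spoke d i) := by
      rw [Bool.eq_iff_iff, beq_iff_eq, decide_eq_true_iff, Sym2.congr_right, eq_comm]
    have e2 : (s(R.spoke d k, d.fst) == s(d.fst, R.spoke d m))
        = decide (R.spoke d m = R.spoke d k) := by
      rw [Bool.eq_iff_iff, beq_iff_eq, decide_eq_true_iff, Sym2.eq_swap, Sym2.congr_right, eq_comm]
    rw [List.count_cons, List.count_nil, e1, e2]
    push_cast
    simp [add_comm]
  have hj : f (R.faceOf ((R.rot ^ j) d)) = f (R.faceOf ((R.rot ^ k) d)) := by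
    have : ∀ m, j ≤ m → m ≤ k → f (R.faceOf ((R.rot ^ j) d)) = f (R.faceOf ((R.rot ^ m) d)) := by
      intro m hm
      induction m, hm using Int.leInduction with
      | base => exact fun _ => rfl
      | succ m hm ih =>
        intro hmk
        rw [hstep m, ← ih (by omega), if_neg (hne i m (by omega) (by omega)).symm,
          if_neg (hne m k (by omega) (by omega)), add_zero, add_zero]
    exact this k hjk.le le_rfl
  have hl : f (R.faceOf ((R.rot ^ (k + 1)) d)) = f (R.faceOf ((R.rot ^ l) d)) := by
    have : ∀ m, k + 1 ≤ m → m ≤ l →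
        f (R.faceOf ((R.rot ^ (k + 1)) d)) = f (R.faceOf ((R.rot ^ m) d)) := by
      intro m hm
      induction m, hm using Int.leInduction with
      | base => exact fun _ => rfl
      | succ m hm ih =>
        intro hmk
        rw [hstep m, ← ih (by omega), if_neg (hne i m (by omega) (by omega)).symm,
          if_neg (hne k m (by omega) (by omega)).symm, add_zero, add_zero]
    exact this l hkl le_rfl
  have hk := hstep k
  rw [if_pos rfl, if_neg (hne i k (by omega) (by omega)).symm, zero_add, hl, ← hj] at hk
  have hend : ∀ m, R.spoke d m ∈ Q.support →
      f (R.faceOf ((R.rot ^ m) d).symm) = f (R.faceOf ((R.rot ^ m) d)) := by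
    intro m hm
    have := hoff ((R.rot ^ m) d).symm (fun h => hQ (h ▸ hm)) (fun h => hdisj _ h hm)
    rw [SimpleGraph.Dart.symm_symm] at this
    exact this.symm
  have h := hside Q hQ hdisj ((R.rot ^ j) d).symm ((R.rot ^ l) d).symm rfl rfl
  rw [hend j Q.start_mem_support, hend l Q.end_mem_support, hk] at h
  simp at h

end RotationSystem

/-! ### Walks inside a vertex set -/

namespace SimpleGraph

variable {V : Type*} {G : SimpleGraph V}

/-- There is a walk from `x` to `y` all of whose vertices lie in `A`. -/
def ReachableIn (G : SimpleGraph V) (A : Set V) (x y : V) : Prop :=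
  ∃ P : G.Walk x y, ∀ z ∈ P.support, z ∈ A

namespace ReachableIn

variable {A : Set V} {x y z : V}

theorem refl (hx : x ∈ A) : G.ReachableIn A x x := ⟨.nil, by simpa using hx⟩

theorem cons (hx : x ∈ A) (h : G.Adj x y) (hyz : G.ReachableIn A y z) : G.ReachableIn A x z := by
  obtain ⟨P, hP⟩ := hyz
  refine ⟨.cons h P, ?_⟩
  simpa [hx] using hP

theorem symm (h : G.ReachableIn A x y) : G.ReachableIn A y x := by
  obtain ⟨P, hP⟩ := h
  exact ⟨P.reverse, by simpa using hP⟩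

theorem trans (h : G.ReachableIn A x y) (h' : G.ReachableIn A y z) : G.ReachableIn A x z := by
  obtain ⟨P, hP⟩ := h
  obtain ⟨Q, hQ⟩ := h'
  refine ⟨P.append Q, fun u hu => ?_⟩
  rcases (Walk.mem_support_append_iff _ _).1 hu with hu | hu
  exacts [hP u hu, hQ u hu]

theorem right_mem (h : G.ReachableIn A x y) : y ∈ A := by
  obtain ⟨P, hP⟩ := h
  exact hP y P.end_mem_support

end ReachableIn

end SimpleGraph

/-! ### Hub configurations, children and links -/

open SimpleGraph (ReachableIn)

/-- A vertex `v` with `n ≥ 8` neighbours `s i` (indexed cyclically) in a graph of girth at least 5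
and diameter at most 3, such that consecutive neighbours are joined by paths
`s i, a i, b i, s (i + 1)` and that connections between alternating pairs of neighbours which avoid
`v` cross. -/
structure HubConfiguration {V : Type*} (G : SimpleGraph V) (v : V) (n : ℤ) where
  s : ℤ → V
  a : ℤ → V
  b : ℤ → V
  eight_le : 8 ≤ n
  adj_s : ∀ i, G.Adj v (s i)
  exists_s_eq : ∀ u, G.Adj v u → ∃ i, s i = u
  s_eq_iff : ∀ i j, s i = s j ↔ n ∣ i - j
  adj_sa : ∀ i, G.Adj (s i) (a i)
  adj_ab : ∀ i, G.Adj (a i) (b i)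
  adj_sb : ∀ i, G.Adj (s (i + 1)) (b i)
  a_ne : ∀ i, a i ≠ v
  b_ne : ∀ i, b i ≠ v
  cross : ∀ {i j k l : ℤ} {A B : Set V}, i < j → j < k → k < l → l < i + n →
    G.ReachableIn A (s i) (s k) → G.ReachableIn B (s j) (s l) → v ∉ A → v ∉ B → ∃ z ∈ A, z ∈ B
  triangle : ∀ {x y z : V}, G.Adj x y → G.Adj y z → G.Adj z x → False
  square : ∀ {x y z w : V}, G.Adj x y → G.Adj y z → G.Adj z w → G.Adj w x → x ≠ z → y ≠ w → False
  short : ∀ x y : V, x = y ∨ G.Adj x y ∨ (∃ z, G.Adj x z ∧ G.Adj z y) ∨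
    ∃ z z', G.Adj x z ∧ G.Adj z z' ∧ G.Adj z' y

namespace HubConfiguration

variable {V : Type*} {G : SimpleGraph V} {v : V} {n : ℤ} (H : HubConfiguration G v n)

/-- `q` is a neighbour of `s i` other than `v`. -/
def Child (i : ℤ) (q : V) : Prop := G.Adj (H.s i) q ∧ q ≠ v

/-- `w` is at distance at least 3 from `v`. -/
def Far (w : V) : Prop := w ≠ v ∧ ¬ G.Adj v w ∧ ∀ i, ¬ G.Adj (H.s i) w

theorem child_a (i : ℤ) : H.Child i (H.a i) := ⟨H.adj_sa i, H.a_ne i⟩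

theorem child_b (i : ℤ) : H.Child (i + 1) (H.b i) := ⟨H.adj_sb i, H.b_ne i⟩

theorem s_ne {i j : ℤ} (hij : i < j) (hji : j < i + n) : H.s i ≠ H.s j := by
  intro h
  rw [eq_comm, H.s_eq_iff] at h
  have := Int.le_of_dvd (by omega) h
  omega

theorem s_add (i : ℤ) : H.s (i + n) = H.s i := by
  rw [H.s_eq_iff]
  simp

theorem eq_or_adj_or_child_or_far (u : V) :
    u = v ∨ G.Adj v u ∨ (∃ i, H.Child i u) ∨ H.Far u := by
  unfold Child Far
  grind

variable {H}

namespace Child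

variable {i j : ℤ} {q q' : V}

theorem not_adj (h : H.Child i q) : ¬ G.Adj v q :=
  fun h' => H.triangle (H.adj_s i) h.1 h'.symm

theorem ne_s (h : H.Child i q) (j : ℤ) : q ≠ H.s j := by
  rintro rfl
  exact h.not_adj (H.adj_s j)

theorem s_eq (h : H.Child i q) (h' : H.Child j q) : H.s i = H.s j := by
  by_contra hne
  exact H.square (H.adj_s i) h.1 h'.1.symm (H.adj_s j).symm h.2.symm hne

theorem not_adj_s (h : H.Child i q) (hne : H.s i ≠ H.s j) : ¬ G.Adj (H.s j) q :=
  fun h' => hne (h.s_eq ⟨h', h.2⟩)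

theorem ne (h : H.Child i q) (h' : H.Child j q') (hne : H.s i ≠ H.s j) : q ≠ q' := by
  rintro rfl
  exact hne (h.s_eq h')

theorem not_far (h : H.Child i q) : ¬ H.Far q := fun h' => h'.2.2 i h.1

theorem of_s_eq (h : H.Child i q) (hij : H.s i = H.s j) : H.Child j q := ⟨hij ▸ h.1, h.2⟩

end Child

variable (H)

/-- `x` and `y` are children of `s i` and of `s k`, respectively, and adjacent or joined by a path
of length 2 whose middle vertex is far from `v`. -/
structure IsLink (i k : ℤ) (x y : V) : Prop where
  left : H.Child i x
  right : H.Child k y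
  ne : H.s i ≠ H.s k
  link : G.Adj x y ∨ ∃ w, G.Adj x w ∧ G.Adj w y ∧ H.Far w

/-- The vertices other than `v` on the cycle through `v` that is closed by a link. -/
def linkCycle (i k : ℤ) (x y : V) : Set V :=
  {z | z = H.s i ∨ z = x ∨ (G.Adj x z ∧ G.Adj z y ∧ H.Far z) ∨ z = y ∨ z = H.s k}

/-- The vertices outside the cycle through `v` that is closed by a link. -/
def offCycle (i k : ℤ) (x y : V) : Set V := {z | z ≠ v ∧ z ∉ H.linkCycle i k x y}

/-- `q` is adjacent to `x` or `y` or the middle vertex of a link from `x` to `y`. -/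
def Touches (x y q : V) : Prop :=
  G.Adj q x ∨ G.Adj q y ∨ ∃ w, G.Adj x w ∧ G.Adj w y ∧ H.Far w ∧ G.Adj q w

/-- `q` is adjacent to `y` or at distance at most 2 from `x` or `s i`. -/
def Near (i : ℤ) (x y q : V) : Prop :=
  G.Adj q y ∨ ∃ m, G.Adj q m ∧ (G.Adj m x ∨ G.Adj m (H.s i))

theorem linkCycle_comm (i k : ℤ) (x y : V) : H.linkCycle i k x y = H.linkCycle k i y x := by
  ext z
  simp only [linkCycle, Set.mem_ofPred_eq, G.adj_comm x, G.adj_comm _ y]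
  tauto

theorem offCycle_comm (i k : ℤ) (x y : V) : H.offCycle i k x y = H.offCycle k i y x := by
  rw [offCycle, linkCycle_comm, ← offCycle]

variable {H}

theorem Child.mem_offCycle {i k l : ℤ} {x y q : V} (hq : H.Child l q) (hx : H.Child i x)
    (hy : H.Child k y) (hi : H.s l ≠ H.s i) (hk : H.s l ≠ H.s k) : q ∈ H.offCycle i k x y := by
  refine ⟨hq.2, ?_⟩
  rintro (h | h | h | h | h)
  exacts [hq.ne_s _ h, hq.ne hx hi h, hq.not_far h.2.2, hq.ne hy hk h, hq.ne_s _ h]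

theorem s_mem_offCycle {i k l : ℤ} {x y : V} (hx : H.Child i x)
    (hy : H.Child k y) (hi : H.s l ≠ H.s i) (hk : H.s l ≠ H.s k) :
    H.s l ∈ H.offCycle i k x y := by
  refine ⟨(H.adj_s l).ne', ?_⟩
  rintro (h | h | h | h | h)
  exacts [hi h, hx.ne_s _ h.symm, h.2.2.2.1 (H.adj_s l), hy.ne_s _ h.symm, hk h]

/-! ### Separation by the cycle of a link -/

namespace IsLink

variable {i j k l : ℤ} {x y p q : V}

theorem symm (h : H.IsLink i k x y) : H.IsLink k i y x where
  left := h.right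
  right := h.left
  ne := h.ne.symm
  link := by
    rcases h.link with h | ⟨w, h1, h2, h3⟩
    · exact Or.inl h.symm
    · exact Or.inr ⟨w, h2.symm, h1.symm, h3⟩

theorem of_s_eq (h : H.IsLink i k x y) (hi : H.s i = H.s j) (hk : H.s k = H.s l) :
    H.IsLink j l x y :=
  ⟨h.left.of_s_eq hi, h.right.of_s_eq hk, fun h' => h.ne (hi.trans (h'.trans hk.symm)), h.link⟩

theorem ne' (h : H.IsLink i k x y) : x ≠ y := h.left.ne h.right h.ne

/-- Only the middle vertex of a link is adjacent to both of its ends. -/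
theorem not_adj_adj (h : H.IsLink i k x y) (hq : ¬ H.Far q) (h1 : G.Adj q x) (h2 : G.Adj q y) :
    False := by
  rcases h.link with h3 | ⟨w, h3, h4, h5⟩
  · exact H.triangle h1 h3 h2.symm
  · exact H.square h1 h3 h4 h2.symm (by rintro rfl; exact hq h5) h.ne'

theorem reachableIn (h : H.IsLink i k x y) :
    G.ReachableIn (H.linkCycle i k x y) (H.s i) (H.s k) := by
  have h1 : H.s k ∈ H.linkCycle i k x y := by simp [linkCycle]
  have h2 : y ∈ H.linkCycle i k x y := by simp [linkCycle]
  have h3 : x ∈ H.linkCycle i k x y := by simp [linkCycle]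
  have h4 : H.s i ∈ H.linkCycle i k x y := by simp [linkCycle]
  have hy : G.ReachableIn (H.linkCycle i k x y) y (H.s k) :=
    .cons h2 h.right.1.symm (.refl h1)
  refine .cons h4 h.left.1 ?_
  rcases h.link with h5 | ⟨w, h5, h6, h7⟩
  · exact .cons h3 h5 hy
  · exact .cons h3 h5 (.cons (by simp [linkCycle, h5, h6, h7]) h6 hy)

theorem hub_notMem (h : H.IsLink i k x y) : v ∉ H.linkCycle i k x y := by
  rintro (h1 | h1 | h1 | h1 | h1)
  exacts [(H.adj_s _).ne h1, h.left.2 h1.symm, h1.2.2.1 rfl, h.right.2 h1.symm, (H.adj_s _).ne h1]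

/-- The Jordan property for the cycle of the link: its part without `v` joins `s i` to `s k`, and
`offCycle` excludes `v`, so `cross` applies. -/
theorem not_reachableIn (h : H.IsLink i k x y) (hij : i < j) (hjk : j < k) (hkl : k < l)
    (hli : l < i + n) : ¬ G.ReachableIn (H.offCycle i k x y) (H.s j) (H.s l) := by
  intro hr
  obtain ⟨z, hz, hz'⟩ := H.cross hij hjk hkl hli h.reachableIn hr h.hub_notMem (fun h => h.1 rfl)
  exact hz'.2 hz

theorem touches_of_adj (h : H.IsLink i k x y) {m : V} (hm : m ∈ H.linkCycle i k x y)
    (hq : H.Child l q) (hi : H.s l ≠ H.s i) (hk : H.s l ≠ H.s k) (hmq : G.Adj m q) :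
    H.Touches x y q := by
  rcases hm with rfl | rfl | hm | rfl | rfl
  · exact absurd hmq (hq.not_adj_s hi)
  · exact Or.inl hmq.symm
  · exact Or.inr (Or.inr ⟨m, hm.1, hm.2.1, hm.2.2, hmq.symm⟩)
  · exact Or.inr (Or.inl hmq.symm)
  · exact absurd hmq (hq.not_adj_s hk)

/-- A vertex on one side of the cycle of a link has a short connection through the cycle to each
child on the other side. -/
theorem touches_or (h : H.IsLink i k x y)
    (hno : ¬ G.ReachableIn (H.offCycle i k x y) (H.s j) (H.s l))
    (hi : H.s l ≠ H.s i) (hk : H.s l ≠ H.s k)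
    (hp : G.ReachableIn (H.offCycle i k x y) (H.s j) p) (hvp : ¬ G.Adj v p) (hq : H.Child l q) :
    H.Touches x y q ∨ ∃ c ∈ H.linkCycle i k x y, G.Adj p c ∧ ∃ m, G.Adj c m ∧ G.Adj m q := by
  have hqo := hq.mem_offCycle h.left h.right hi hk
  have hql : G.ReachableIn (H.offCycle i k x y) q (H.s l) :=
    .cons hqo hq.1.symm (.refl (s_mem_offCycle h.left h.right hi hk))
  have hpo := hp.right_mem
  have hoff : ∀ {u w : V}, ¬ G.Adj v u → G.Adj u w → w ∉ H.linkCycle i k x y →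
      w ∈ H.offCycle i k x y := by
    intro u w hu huw hw
    refine ⟨?_, hw⟩
    rintro rfl
    exact hu huw.symm
  -- An inner vertex of the short path lies on the cycle, and no inner vertex is `v`, because
  -- neither end is adjacent to `v`. If the last inner vertex is on the cycle, `q` touches the link;
  -- otherwise the first of two is the vertex `c`.
  rcases H.short p q with rfl | h1 | ⟨m, h1, h2⟩ | ⟨m, m', h1, h2, h3⟩
  · exact absurd (hp.trans hql) hno
  · exact absurd (hp.trans (.cons hpo h1 hql)) hno
  · by_cases hm : m ∈ H.linkCycle i k x y
    · exact Or.inl (h.touches_of_adj hm hq hi hk h2)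
    · exact absurd (hp.trans (.cons hpo h1 (.cons (hoff hvp h1 hm) h2 hql))) hno
  · by_cases hm' : m' ∈ H.linkCycle i k x y
    · exact Or.inl (h.touches_of_adj hm' hq hi hk h3)
    · by_cases hm : m ∈ H.linkCycle i k x y
      · exact Or.inr ⟨m, hm, h1, m', h2, h3⟩
      · exact absurd (hp.trans (.cons hpo h1 (.cons (hoff hvp h1 hm) h2
          (.cons (hoff hq.not_adj h3.symm hm') h3 hql)))) hno

theorem near_of_touches (h : H.IsLink i k x y) (hq : H.Touches x y q) : H.Near i x y q := by
  rcases hq with h1 | h1 | ⟨w, h1, h2, h3, h4⟩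
  · exact Or.inr ⟨x, h1, Or.inr h.left.1.symm⟩
  · exact Or.inl h1
  · exact Or.inr ⟨w, h4, Or.inl h1.symm⟩

theorem touches_comm : H.Touches x y q ↔ H.Touches y x q := by
  simp only [Touches, G.adj_comm x, G.adj_comm _ y]
  constructor <;> rintro (h | h | ⟨w, h1, h2, h3, h4⟩) <;> grind

/-- The vertices `a` and `b` of the face next to spoke `i` are starting points for `touches_or`. By
the girth, one of them lies off the cycle and has no neighbours on it except possibly `x` and `s i`,
so a short path from it to `q` enters the cycle there. -/
theorem near (h : H.IsLink i k x y)
    (hno : ¬ G.ReachableIn (H.offCycle i k x y) (H.s j) (H.s l))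
    (hji : H.s j ≠ H.s i) (hjk : H.s j ≠ H.s k) (hli : H.s l ≠ H.s i) (hlk : H.s l ≠ H.s k)
    {a b : V} (ha : H.Child i a) (hb : H.Child j b) (hab : G.Adj a b) (hq : H.Child l q) :
    H.Near i x y q := by
  have hbr : G.ReachableIn (H.offCycle i k x y) (H.s j) b :=
    .cons (s_mem_offCycle h.left h.right hji hjk) hb.1
      (.refl (hb.mem_offCycle h.left h.right hji hjk))
  have key : ∀ p, ¬ G.Adj v p → G.ReachableIn (H.offCycle i k x y) (H.s j) p →
      (∀ c ∈ H.linkCycle i k x y, G.Adj p c → c = x ∨ c = H.s i) → H.Near i x y q := by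
    intro p hvp hp hpc
    rcases h.touches_or hno hli hlk hp hvp hq with h1 | ⟨c, hc, h1, m, h2, h3⟩
    · exact h.near_of_touches h1
    · rcases hpc c hc h1 with rfl | rfl
      · exact Or.inr ⟨m, h3.symm, Or.inl h2.symm⟩
      · exact Or.inr ⟨m, h3.symm, Or.inr h2.symm⟩
  have hx := h.left
  have hy := h.right
  by_cases hbx : ∀ c ∈ H.linkCycle i k x y, G.Adj b c → c = x ∨ c = H.s i
  · exact key b hb.not_adj hbr hbx
  -- Now `b` is adjacent to `y` or to the middle vertex of the link. Then `b` is not adjacent to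
  -- `x`, so `a` is off the cycle and replaces `b`.
  · push Not at hbx
    obtain ⟨c, hc, hbc, hcx, hci⟩ := hbx
    have hnx : ¬ G.Adj b x := by
      intro hbx
      rcases hc with hc | hc | hc | rfl | rfl
      · exact hci hc
      · exact hcx hc
      · exact H.triangle hbx hc.1 hbc.symm
      · exact h.not_adj_adj hb.not_far hbx hbc
      · exact hb.not_adj_s hjk hbc.symm
    have hax : a ≠ x := by
      rintro rfl
      exact hnx hab.symm
    have hao : a ∈ H.offCycle i k x y := by
      refine ⟨ha.2, ?_⟩
      rintro (h1 | h1 | h1 | h1 | h1)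
      exacts [ha.ne_s _ h1, hax h1, ha.not_far h1.2.2, ha.ne hy h.ne h1, ha.ne_s _ h1]
    refine key a ha.not_adj (hbr.trans (.cons hbr.right_mem hab.symm (.refl hao))) ?_
    rintro c' (h1 | h1 | h1 | rfl | rfl) hac
    · exact Or.inr h1
    · exact Or.inl h1
    · exact (H.square ha.1 hac h1.1.symm hx.1.symm
        (by rintro rfl; exact h1.2.2.2.1 (H.adj_s i)) hax).elim
    · exfalso
      rcases hc with hc | hc | hc | rfl | rfl
      · exact hci hc
      · exact hcx hc
      · exact H.square hab hbc hc.2.1 hac.symm (by rintro rfl; exact ha.not_far hc.2.2)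
          (hb.ne hy hjk)
      · exact H.triangle hab hbc hac.symm
      · exact hb.not_adj_s hjk hbc.symm
    · exact absurd hac.symm (ha.not_adj_s h.ne)

end IsLink

end HubConfiguration

/-! ### Excluding links between spokes that are not consecutive -/

namespace HubConfiguration

variable {V : Type*} {G : SimpleGraph V} {v : V} {n : ℤ} {H : HubConfiguration G v n}

namespace IsLink

variable {i j k l : ℤ} {x y p q : V}

theorem near_left (h : H.IsLink i k x y) (hik : i + 1 < k) (hkl : k < l) (hli : l < i + n)
    (hq : H.Child l q) : H.Near i x y q :=
  h.near (h.not_reachableIn (j := i + 1) (by omega) hik hkl hli)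
    (H.s_ne (by omega) (by omega)).symm (H.s_ne (by omega) (by omega))
    (H.s_ne (by omega) (by omega)).symm (H.s_ne (by omega) (by omega)).symm
    (H.child_a i) (H.child_b i) (H.adj_ab i) hq

theorem near_right (h : H.IsLink i k x y) (hik : i + 1 < k) (hkl : k < l) (hli : l < i + n)
    (hq : H.Child l q) : H.Near k y x q := by
  have hb := H.child_b (k - 1)
  rw [sub_add_cancel] at hb
  refine h.symm.near (j := k - 1) (l := l) ?_
    (H.s_ne (by omega) (by omega)) (H.s_ne (by omega) (by omega)).symm
    (H.s_ne (by omega) (by omega)).symm (H.s_ne (by omega) (by omega)).symm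
    hb (H.child_a (k - 1)) (H.adj_ab (k - 1)).symm hq
  rw [H.offCycle_comm]
  exact h.not_reachableIn (by omega) (by omega) hkl hli

/-- Connections of children of two different spokes to the opposite ends of a link cross. -/
theorem adj_or_common_neighbor (h : H.IsLink i k x y) {l' : ℤ} {q' : V} (hik : i < k)
    (hkl : k < l) (hll : l < l') (hli : l' < i + n) (hq : H.Child l q) (hq' : H.Child l' q')
    (hA : H.Near i x y q) (hB : H.Near k y x q') :
    G.Adj q y ∨ G.Adj q' x ∨ ∃ m, G.Adj q m ∧ G.Adj m q' ∧ (G.Adj m x ∨ G.Adj m (H.s i)) ∧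
      (G.Adj m y ∨ G.Adj m (H.s k)) := by
  by_contra! hcon
  obtain ⟨hqy, hqx, hno⟩ := hcon
  obtain ⟨m, hm, hm'⟩ := hA.resolve_left hqy
  obtain ⟨m', hn, hn'⟩ := hB.resolve_left hqx
  have hx := h.left
  have hy := h.right
  have e1 : H.s l ≠ H.s i := (H.s_ne (by omega) (by omega)).symm
  have e2 : H.s l ≠ H.s k := (H.s_ne (by omega) (by omega)).symm
  have e3 : H.s l' ≠ H.s i := (H.s_ne (by omega) (by omega)).symm
  have e4 : H.s l' ≠ H.s k := (H.s_ne (by omega) (by omega)).symm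
  have e5 : H.s l ≠ H.s l' := H.s_ne (by omega) (by omega)
  -- Spoke `i` is written as `i + n`, so that the four ends appear in the order `k < l < l' < i +
  -- n`.
  have hQ : G.ReachableIn {H.s l, q, m, x, H.s i} (H.s l) (H.s (i + n)) := by
    rw [H.s_add]
    refine .cons (by simp) hq.1 (.cons (by simp) hm ?_)
    rcases hm' with hm' | hm'
    · exact .cons (by simp) hm' (.cons (by simp) hx.1.symm (.refl (by simp)))
    · exact .cons (by simp) hm' (.refl (by simp))
  have hP : G.ReachableIn {H.s l', q', m', y, H.s k} (H.s k) (H.s l') := by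
    refine .symm (.cons (by simp) hq'.1 (.cons (by simp) hn ?_))
    rcases hn' with hn' | hn'
    · exact .cons (by simp) hn' (.cons (by simp) hy.1.symm (.refl (by simp)))
    · exact .cons (by simp) hn' (.refl (by simp))
  have hv1 : v ∉ ({H.s l', q', m', y, H.s k} : Set V) := by
    rintro (h1 | h1 | h1 | h1 | h1)
    exacts [(H.adj_s _).ne h1, hq'.2 h1.symm, hq'.not_adj (h1 ▸ hn.symm), hy.2 h1.symm,
      (H.adj_s _).ne h1]
  have hv2 : v ∉ ({H.s l, q, m, x, H.s i} : Set V) := by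
    rintro (h1 | h1 | h1 | h1 | h1)
    exacts [(H.adj_s _).ne h1, hq.2 h1.symm, hq.not_adj (h1 ▸ hm.symm), hx.2 h1.symm,
      (H.adj_s _).ne h1]
  have hqi := hq.not_adj_s e1
  have hqk := hq.not_adj_s e2
  have hql := hq.not_adj_s e5
  have hqi' := hq'.not_adj_s e3
  have hqk' := hq'.not_adj_s e4
  have hql' := hq'.not_adj_s e5.symm
  -- Every coincidence except `m = m'` contradicts the girth or the failure of the first two
  -- alternatives; `m = m'` is the third alternative.
  obtain ⟨z, hz, hz'⟩ := H.cross hkl hll (by omega) (by omega) hP hQ hv1 hv2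
  rcases hz' with rfl | rfl | rfl | rfl | rfl
  · rcases hz with h1 | h1 | h1 | h1 | h1
    exacts [e5 h1, hq'.ne_s _ h1.symm, hql' (h1 ▸ hn.symm), hy.ne_s _ h1.symm, e2 h1]
  · rcases hz with h1 | h1 | rfl | h1 | h1
    · exact hq.ne_s _ h1
    · exact hq.ne hq' e5 h1
    · exact hn'.elim hqy fun h2 => hqk h2.symm
    · exact hq.ne hy e2 h1
    · exact hq.ne_s _ h1
  · rcases hz with rfl | rfl | rfl | rfl | rfl
    · exact hql hm.symm
    · exact hm'.elim hqx fun h2 => hqi' h2.symm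
    · exact hn'.elim (hno _ hm hn.symm hm').1 (hno _ hm hn.symm hm').2
    · exact hqy hm
    · exact hqk hm.symm
  · rcases hz with h1 | h1 | rfl | h1 | h1
    · exact hx.ne_s _ h1
    · exact hx.ne hq' e3.symm h1
    · exact hqx hn
    · exact h.ne' h1
    · exact hx.ne_s _ h1
  · rcases hz with h1 | h1 | h1 | h1 | h1
    exacts [e3 h1.symm, hq'.ne_s _ h1.symm, hqi' (h1 ▸ hn.symm), hy.ne_s _ h1.symm, h.ne h1]

/-- There is no link with a spoke on one side and four spokes on the other. -/
theorem false_of_four_le (h : H.IsLink i k x y) (hik : i + 2 ≤ k) (hki : k + 5 ≤ i + n) :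
    False := by
  have hx := h.left
  have hy := h.right
  have e : ∀ l, k < l → l < i + n → H.s l ≠ H.s i ∧ H.s l ≠ H.s k := fun l h1 h2 =>
    ⟨(H.s_ne (by omega) (by omega)).symm, (H.s_ne (by omega) (by omega)).symm⟩
  have Z : ∀ {l l' : ℤ} {q q' : V}, k < l → l < l' → l' < i + n → H.Child l q → H.Child l' q' →
      G.Adj q y ∨ G.Adj q' x ∨ ∃ m, G.Adj q m ∧ G.Adj m q' ∧ (G.Adj m x ∨ G.Adj m (H.s i)) ∧
      (G.Adj m y ∨ G.Adj m (H.s k)) := fun h1 h2 h3 hq hq' =>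
    h.adj_or_common_neighbor (by omega) h1 h2 h3 hq hq'
      (h.near_left (by omega) h1 (by omega) hq) (h.near_right (by omega) (by omega) h3 hq')
  -- The edges `q₁q₂` and `q₃q₄` of two faces provide children of the four spokes `k + 1`, ..., `k +
  -- 4`. The ends of an edge have no common neighbour, so `Z` reduces to its first two alternatives
  -- for these pairs.
  have c1 := H.child_a (k + 1)
  have c2 := H.child_b (k + 1)
  have c3 := H.child_a (k + 3)
  have c4 := H.child_b (k + 3)
  have a12 := H.adj_ab (k + 1)
  have a34 := H.adj_ab (k + 3)
  rw [add_assoc] at c2 c4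
  norm_num at c2 c4
  generalize H.a (k + 1) = q₁ at *
  generalize H.b (k + 1) = q₂ at *
  generalize H.a (k + 3) = q₃ at *
  generalize H.b (k + 3) = q₄ at *
  have z12 : G.Adj q₁ y ∨ G.Adj q₂ x := by
    rcases Z (by omega) (by omega) (by omega) c1 c2 with h1 | h1 | ⟨m, h1, h2, -⟩
    exacts [Or.inl h1, Or.inr h1, (H.triangle a12 h2.symm h1.symm).elim]
  have z34 : G.Adj q₃ y ∨ G.Adj q₄ x := by
    rcases Z (by omega) (by omega) (by omega) c3 c4 with h1 | h1 | ⟨m, h1, h2, -⟩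
    exacts [Or.inl h1, Or.inr h1, (H.triangle a34 h2.symm h1.symm).elim]
  have h2y : ¬ G.Adj q₂ y := fun h2 => by
    rcases z12 with h1 | h1
    exacts [H.triangle a12 h2 h1.symm, h.not_adj_adj c2.not_far h1 h2]
  have h3x : ¬ G.Adj q₃ x := fun h3 => by
    rcases z34 with h1 | h1
    exacts [h.not_adj_adj c3.not_far h3 h1, H.triangle a34 h1 h3.symm]
  -- The common neighbour `m` of `q₂` and `q₃` turns out to be adjacent to neither `x` nor `y`. It
  -- is then adjacent to `s i` and `s k`, which closes a 4-cycle through `v`.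
  obtain ⟨m, hm2, hm3, hmx, hmy⟩ :=
    ((Z (by omega) (by omega) (by omega) c2 c3).resolve_left h2y).resolve_left h3x
  have e2 := e (k + 2) (by omega) (by omega)
  have e3 := e (k + 3) (by omega) (by omega)
  have e4 := e (k + 4) (by omega) (by omega)
  have e1 := e (k + 1) (by omega) (by omega)
  have h2x : ¬ G.Adj q₂ x := fun h2 => by
    rcases hmx with h1 | h1
    · exact H.triangle h2 h1.symm hm2.symm
    · exact H.square hm2 h1 hx.1 h2.symm (c2.ne_s i) (by rintro rfl; exact h3x hm3.symm)
  have h1y := z12.resolve_right h2x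
  have hm_y : ¬ G.Adj m y := fun h5 => by
    refine H.square a12 hm2 h5 h1y.symm ?_ (c2.ne hy e2.2)
    rintro rfl
    rcases hmx with h6 | h6
    exacts [h.not_adj_adj c1.not_far h6 h1y, c1.not_adj_s e1.1 h6.symm]
  have hmk := hmy.resolve_left hm_y
  have h3y : ¬ G.Adj q₃ y := fun h3 =>
    H.square hm3.symm hmk hy.1 h3.symm (c3.ne_s k) (by rintro rfl; exact h2y hm2)
  have h4x := z34.resolve_left h3y
  have hm_x : ¬ G.Adj m x := fun h5 => by
    refine H.square a34.symm hm3.symm h5 h4x.symm ?_ (c3.ne hx e3.1)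
    rintro rfl
    exact c4.not_adj_s e4.2 hmk.symm
  refine H.square (H.adj_s i) (hmx.resolve_left hm_x).symm hmk (H.adj_s k).symm ?_ h.ne
  rintro rfl
  exact c2.not_adj hm2.symm

/-- If there are exactly three spokes on either side of a link, some child on the far side does not
touch the link. -/
theorem not_forall_touches (h : H.IsLink i k x y) (hik : i + 2 ≤ k) (hki : k + 4 ≤ i + n) :
    ¬ ∀ l q, k < l → l < i + n → H.Child l q → H.Touches x y q := by
  intro hT
  have hx := h.left
  have hy := h.right
  have e : ∀ l, k < l → l < i + n → H.s l ≠ H.s i ∧ H.s l ≠ H.s k := fun l h1 h2 =>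
    ⟨(H.s_ne (by omega) (by omega)).symm, (H.s_ne (by omega) (by omega)).symm⟩
  -- Of the two adjacencies, one comes from `adj_or_common_neighbor`; the other is the only way of
  -- touching the link that the girth then permits.
  have key : ∀ {l l' : ℤ} {q q' : V}, k < l → l < l' → l' < i + n → H.Child l q → H.Child l' q' →
      G.Adj q q' → G.Adj q y ∧ G.Adj q' x := by
    intro l l' q q' h1 h2 h3 hq hq' hqq
    have e1 := e l (by omega) (by omega)
    have e2 := e l' (by omega) (by omega)
    have hn : G.Adj q y ∨ G.Adj q' x := by
      rcases h.adj_or_common_neighbor (by omega) h1 h2 h3 hq hq'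
        (h.near_left (by omega) h1 (by omega) hq) (h.near_right (by omega) (by omega) h3 hq')
        with h1 | h1 | ⟨m, h1, h2, -⟩
      exacts [Or.inl h1, Or.inr h1, (H.triangle hqq h2.symm h1.symm).elim]
    rcases hn with h4 | h4
    · refine ⟨h4, ?_⟩
      rcases hT l' q' (by omega) (by omega) hq' with h5 | h5 | ⟨w, -, h5, h6, h7⟩
      · exact h5
      · exact (H.triangle hqq h5 h4.symm).elim
      · exact (H.square hqq h7 h5 h4.symm (by rintro rfl; exact hq.not_far h6)
          (hq'.ne hy e2.2)).elim
    · refine ⟨?_, h4⟩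
      rcases hT l q (by omega) (by omega) hq with h5 | h5 | ⟨w, h5, -, h6, h7⟩
      · exact (H.triangle hqq h4 h5.symm).elim
      · exact h5
      · exact (H.square hqq.symm h7 h5.symm h4.symm (by rintro rfl; exact hq'.not_far h6)
          (hq.ne hx e1.1)).elim
  have c1 := H.child_a (k + 1)
  have c2 := H.child_b (k + 1)
  have c3 := H.child_a (k + 2)
  have c4 := H.child_b (k + 2)
  have a12 := H.adj_ab (k + 1)
  have a34 := H.adj_ab (k + 2)
  rw [add_assoc] at c2 c4
  norm_num at c2 c4
  generalize H.a (k + 1) = q₁ at *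
  generalize H.b (k + 1) = q₂ at *
  generalize H.a (k + 2) = q₃ at *
  generalize H.b (k + 2) = q₄ at *
  obtain ⟨-, h2⟩ := key (by omega) (by omega) (by omega) c1 c2 a12
  obtain ⟨h3, -⟩ := key (by omega) (by omega) (by omega) c3 c4 a34
  have e2 := e (k + 2) (by omega) (by omega)
  have e3 := e (k + 3) (by omega) (by omega)
  have e23 : H.s (k + 2) ≠ H.s (k + 3) := H.s_ne (by omega) (by omega)
  -- The face edges force `q₃` next to `y` and `q₂` next to `x`, in crossing position. The resulting
  -- paths are disjoint: even `q₂ = q₃`, both children of `s (k + 2)`, would be adjacent to both `x`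
  -- and `y`.
  have hP : G.ReachableIn {H.s k, y, q₃, q₄, H.s (k + 3)} (H.s k) (H.s (k + 3)) :=
    .cons (by simp) hy.1 (.cons (by simp) h3.symm (.cons (by simp) a34
      (.cons (by simp) c4.1.symm (.refl (by simp)))))
  have hQ : G.ReachableIn {H.s (k + 2), q₂, x, H.s i} (H.s (k + 2)) (H.s (i + n)) := by
    rw [H.s_add]
    exact .cons (by simp) c2.1 (.cons (by simp) h2 (.cons (by simp) hx.1.symm (.refl (by simp))))
  have hv1 : v ∉ ({H.s k, y, q₃, q₄, H.s (k + 3)} : Set V) := by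
    rintro (h1 | h1 | h1 | h1 | h1)
    exacts [(H.adj_s _).ne h1, hy.2 h1.symm, c3.2 h1.symm, c4.2 h1.symm, (H.adj_s _).ne h1]
  have hv2 : v ∉ ({H.s (k + 2), q₂, x, H.s i} : Set V) := by
    rintro (h1 | h1 | h1 | h1)
    exacts [(H.adj_s _).ne h1, c2.2 h1.symm, hx.2 h1.symm, (H.adj_s _).ne h1]
  obtain ⟨z, hz, hz'⟩ := H.cross (by omega) (by omega) (by omega) (by omega) hP hQ hv1 hv2
  rcases hz with rfl | rfl | rfl | rfl | rfl
  · rcases hz' with h1 | h1 | h1 | h1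
    exacts [e2.2 h1.symm, c2.ne_s _ h1.symm, hx.ne_s _ h1.symm, h.ne h1.symm]
  · rcases hz' with h1 | h1 | h1 | h1
    exacts [hy.ne_s _ h1, c2.ne hy e2.2 h1.symm, h.ne' h1.symm, hy.ne_s _ h1]
  · rcases hz' with h1 | rfl | h1 | h1
    exacts [c3.ne_s _ h1, h.not_adj_adj c2.not_far h2 h3, c3.ne hx e2.1 h1, c3.ne_s _ h1]
  · rcases hz' with h1 | h1 | h1 | h1
    exacts [c4.ne_s _ h1, c2.ne c4 e23 h1.symm, c4.ne hx e3.1 h1, c4.ne_s _ h1]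
  · rcases hz' with h1 | h1 | h1 | h1
    exacts [e23 h1.symm, c2.ne_s _ h1.symm, hx.ne_s _ h1.symm, e3.1 h1]

/-- The children on one side of a link or those on the other side all touch the link. -/
theorem touches_or_touches (h : H.IsLink i k x y) (hij : i < j) (hjk : j < k) (hkl : k < l)
    (hli : l < i + n) (hp : H.Child j p) (hq : H.Child l q) :
    H.Touches x y p ∨ H.Touches x y q := by
  have e1 : H.s j ≠ H.s i := (H.s_ne (by omega) (by omega)).symm
  have e2 : H.s j ≠ H.s k := H.s_ne (by omega) (by omega)
  have e3 : H.s l ≠ H.s i := (H.s_ne (by omega) (by omega)).symm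
  have e4 : H.s l ≠ H.s k := (H.s_ne (by omega) (by omega)).symm
  rcases h.touches_or (h.not_reachableIn hij hjk hkl hli) e3 e4
    (.cons (s_mem_offCycle h.left h.right e1 e2) hp.1
      (.refl (hp.mem_offCycle h.left h.right e1 e2))) hp.not_adj hq with h1 | ⟨c, hc, h1, -⟩
  · exact Or.inr h1
  · exact Or.inl (h.touches_of_adj hc hp e1 e2 h1.symm)

/-- Links exist between children of consecutive spokes only. -/
theorem false_of_two_le (h : H.IsLink i k x y) (hik : i + 2 ≤ k) (hki : k + 2 ≤ i + n) : False := by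
  have hs : H.IsLink k (i + n) y x := h.symm.of_s_eq rfl (H.s_add i).symm
  have h8 := H.eight_le
  by_cases h1 : k + 5 ≤ i + n
  · exact h.false_of_four_le hik h1
  by_cases h2 : i + 5 ≤ k
  · exact hs.false_of_four_le hki (by omega)
  -- Neither side has four spokes and `n ≥ 8`, so `n = 8` and `k = i + 4`, with three spokes on each
  -- side.
  have h3 := h.not_forall_touches hik (by omega)
  have h4 := hs.not_forall_touches hki (by omega)
  push Not at h3 h4
  obtain ⟨l, q, hl, hl', hq, hTq⟩ := h3
  obtain ⟨j, p, hj, hj', hp, hTp⟩ := h4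
  have hp' : H.Child (j - n) p := hp.of_s_eq (by rw [H.s_eq_iff]; simp)
  rcases h.touches_or_touches (j := j - n) (by omega) (by omega) hl hl' hp' hq with h5 | h5
  exacts [hTp (touches_comm.1 h5), hTq h5]

end IsLink

/-! ### Paths through far vertices -/

variable (H)

theorem exists_s_eq_of_le {u : V} (hu : G.Adj v u) (m : ℤ) :
    ∃ i, m ≤ i ∧ i < m + n ∧ H.s i = u := by
  obtain ⟨i, rfl⟩ := H.exists_s_eq u hu
  have hn : 0 < n := by have := H.eight_le; omega
  refine ⟨m + (i - m) % n, ?_, ?_, ?_⟩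
  · have := Int.emod_nonneg (i - m) hn.ne'; omega
  · have := Int.emod_lt_of_pos (i - m) hn; omega
  · rw [H.s_eq_iff]
    have := Int.emod_add_mul_ediv (i - m) n
    exact ⟨-((i - m) / n), by linarith⟩

variable {H}

/-- Following a link changes the spoke index by at most one. The index of `z` is determined only
modulo `n`, so it is chosen in the window that starts at `i - 1`. -/
theorem Child.exists_of_link {i j : ℤ} {x z : V} (hx : H.Child i x) (hz : H.Child j z)
    (hl : G.Adj x z ∨ ∃ w, G.Adj x w ∧ G.Adj w z ∧ H.Far w) :
    ∃ k, i - 1 ≤ k ∧ k ≤ i + 1 ∧ H.Child k z := by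
  obtain ⟨k, h1, h2, h3⟩ := H.exists_s_eq_of_le (H.adj_s j) (i - 1)
  refine ⟨k, h1, ?_, hz.of_s_eq h3.symm⟩
  by_contra hk
  have h8 := H.eight_le
  exact IsLink.false_of_two_le (H := H) (i := i) (k := k)
    ⟨hx, hz.of_s_eq h3.symm, H.s_ne (by omega) (by omega), hl⟩ (by omega) (by omega)

/-- Children of spokes that are at least four steps apart are joined by a path of length 3 whose
inner vertices are far from `v`. -/
theorem Child.exists_far_far {i k : ℤ} {x y : V} (hx : H.Child i x) (hy : H.Child k y)
    (hik : i + 4 ≤ k) (hki : k + 4 ≤ i + n) :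
    ∃ z z', G.Adj x z ∧ G.Adj z z' ∧ G.Adj z' y ∧ H.Far z ∧ H.Far z' := by
  -- A short path from `x` to `y` splits into at most three pieces, each a link or a detour through
  -- a spoke, which keeps the index. The index thus moves by at most 3, unless the path has two
  -- inner vertices, both far.
  have hstep : ∀ j, i - 3 ≤ j → j ≤ i + 3 → ¬ H.Child j y := by
    intro j h1 h2 hj
    have h3 := hj.s_eq hy
    rcases lt_trichotomy j k with h4 | h4 | h4
    exacts [H.s_ne h4 (by omega) h3, by omega, by omega]
  rcases H.short x y with rfl | h1 | ⟨m, h1, h2⟩ | ⟨m, m', h1, h2, h3⟩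
  · exact absurd hx (hstep i (by omega) (by omega))
  · obtain ⟨j, h2, h3, h4⟩ := hx.exists_of_link hy (Or.inl h1)
    exact absurd h4 (hstep j (by omega) (by omega))
  · exfalso
    rcases H.eq_or_adj_or_child_or_far m with rfl | h3 | ⟨j, h3⟩ | h3
    · exact hx.not_adj h1.symm
    · obtain ⟨j, rfl⟩ := H.exists_s_eq m h3
      exact hstep i (by omega) (by omega)
        (Child.of_s_eq (i := j) ⟨h2, hy.2⟩ (Child.s_eq ⟨h1.symm, hx.2⟩ hx))
    · obtain ⟨j, h4, h5, h6⟩ := hx.exists_of_link h3 (Or.inl h1)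
      obtain ⟨j', h7, h8, h9⟩ := h6.exists_of_link hy (Or.inl h2)
      exact hstep j' (by omega) (by omega) h9
    · obtain ⟨j, h4, h5, h6⟩ := hx.exists_of_link hy (Or.inr ⟨m, h1, h2, h3⟩)
      exact hstep j (by omega) (by omega) h6
  · rcases H.eq_or_adj_or_child_or_far m with rfl | h4 | ⟨j, h4⟩ | h4
    · exact absurd h1.symm hx.not_adj
    · exfalso
      obtain ⟨j, rfl⟩ := H.exists_s_eq m h4
      have hj : H.s j = H.s i := Child.s_eq ⟨h1.symm, hx.2⟩ hx
      have hm' : H.Child j m' := ⟨h2, by rintro rfl; exact hy.not_adj h3⟩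
      obtain ⟨j', h5, h6, h7⟩ := (hm'.of_s_eq hj).exists_of_link hy (Or.inl h3)
      exact hstep j' (by omega) (by omega) h7
    · exfalso
      obtain ⟨j, h5, h6, h7⟩ := hx.exists_of_link h4 (Or.inl h1)
      rcases H.eq_or_adj_or_child_or_far m' with rfl | h8 | ⟨l, h8⟩ | h8
      · exact hy.not_adj h3
      · obtain ⟨l, rfl⟩ := H.exists_s_eq m' h8
        have hl : H.s l = H.s j := Child.s_eq ⟨h2.symm, h4.2⟩ h7
        exact hstep j (by omega) (by omega) (Child.of_s_eq (i := l) ⟨h3, hy.2⟩ hl)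
      · obtain ⟨j', h9, h10, h11⟩ := h7.exists_of_link h8 (Or.inl h2)
        obtain ⟨l', h12, h13, h14⟩ := h11.exists_of_link hy (Or.inl h3)
        exact hstep l' (by omega) (by omega) h14
      · obtain ⟨l', h12, h13, h14⟩ := h7.exists_of_link hy (Or.inr ⟨m', h2, h3, h8⟩)
        exact hstep l' (by omega) (by omega) h14
    · rcases H.eq_or_adj_or_child_or_far m' with rfl | h8 | ⟨l, h8⟩ | h8
      · exact absurd h3 hy.not_adj
      · obtain ⟨l, rfl⟩ := H.exists_s_eq m' h8
        exact absurd h2.symm (h4.2.2 l)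
      · exfalso
        obtain ⟨j', h9, h10, h11⟩ := hx.exists_of_link h8 (Or.inr ⟨m, h1, h2, h4⟩)
        obtain ⟨l', h12, h13, h14⟩ := h11.exists_of_link hy (Or.inl h3)
        exact hstep l' (by omega) (by omega) h14
      · exact ⟨m, m', h1, h2, h3, h4, h8⟩

/-- A path of length 3 between children four spokes apart separates children of the spokes halfway
on either side; a path of length 3 between the latter has to cross it, which gives a link between
spokes that are not consecutive. -/
theorem not_child {i : ℤ} {x : V} : ¬ H.Child i x := by
  intro hx
  have h8 := H.eight_le
  -- Since `n ≥ 8`, the offsets 0, 4 and the offsets 2, 6 are four steps apart both ways around, and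
  -- any two of the four offsets are at least two steps apart both ways.
  have hp := H.child_a (i + 2)
  have hy := H.child_a (i + 4)
  have hq := H.child_a (i + 6)
  generalize H.a (i + 2) = p at hp
  generalize H.a (i + 4) = y at hy
  generalize H.a (i + 6) = q at hq
  obtain ⟨z, z', h1, h2, h3, hz, hz'⟩ := hx.exists_far_far hy (by omega) (by omega)
  obtain ⟨w, w', h4, h5, h6, hw, hw'⟩ := hp.exists_far_far hq (by omega) (by omega)
  have e1 : H.s i ≠ H.s (i + 2) := H.s_ne (by omega) (by omega)
  have e2 : H.s i ≠ H.s (i + 6) := H.s_ne (by omega) (by omega)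
  have e3 : H.s (i + 2) ≠ H.s (i + 4) := H.s_ne (by omega) (by omega)
  have e4 : H.s (i + 4) ≠ H.s (i + 6) := H.s_ne (by omega) (by omega)
  have hP : G.ReachableIn {H.s i, x, z, z', y, H.s (i + 4)} (H.s i) (H.s (i + 4)) :=
    .cons (by simp) hx.1 (.cons (by simp) h1 (.cons (by simp) h2 (.cons (by simp) h3
      (.cons (by simp) hy.1.symm (.refl (by simp))))))
  have hQ : G.ReachableIn {H.s (i + 2), p, w, w', q, H.s (i + 6)} (H.s (i + 2)) (H.s (i + 6)) :=
    .cons (by simp) hp.1 (.cons (by simp) h4 (.cons (by simp) h5 (.cons (by simp) h6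
      (.cons (by simp) hq.1.symm (.refl (by simp))))))
  have hv1 : v ∉ ({H.s i, x, z, z', y, H.s (i + 4)} : Set V) := by
    rintro (h1 | h1 | h1 | h1 | h1 | h1)
    exacts [(H.adj_s _).ne h1, hx.2 h1.symm, hz.1 h1.symm, hz'.1 h1.symm, hy.2 h1.symm,
      (H.adj_s _).ne h1]
  have hv2 : v ∉ ({H.s (i + 2), p, w, w', q, H.s (i + 6)} : Set V) := by
    rintro (h1 | h1 | h1 | h1 | h1 | h1)
    exacts [(H.adj_s _).ne h1, hp.2 h1.symm, hw.1 h1.symm, hw'.1 h1.symm, hq.2 h1.symm,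
      (H.adj_s _).ne h1]
  have hfs : ∀ {u : V} (j : ℤ), H.Far u → u ≠ H.s j := by
    rintro u j hu rfl
    exact hu.2.1 (H.adj_s j)
  have hfc : ∀ {u c : V} {j : ℤ}, H.Far u → H.Child j c → u ≠ c := by
    rintro u _ j hu hc rfl
    exact hc.not_far hu
  obtain ⟨u, hu, hu'⟩ := H.cross (by omega) (by omega) (by omega) (by omega) hP hQ hv1 hv2
  -- Only far vertices of the two paths can coincide. Such a vertex is adjacent to one of `x`, `y`
  -- and to one of `p`, `q`, so it is the middle of a link.
  rcases hu with rfl | rfl | rfl | rfl | rfl | rfl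
  · rcases hu' with h | h | h | h | h | h
    exacts [e1 h, hp.ne_s _ h.symm, hfs _ hw h.symm, hfs _ hw' h.symm, hq.ne_s _ h.symm, e2 h]
  · rcases hu' with h | h | h | h | h | h
    exacts [hx.ne_s _ h, hx.ne hp e1 h, hfc hw hx h.symm, hfc hw' hx h.symm, hx.ne hq e2 h,
      hx.ne_s _ h]
  · rcases hu' with h | h | rfl | rfl | h | h
    · exact hfs _ hz h
    · exact hfc hz hp h
    · exact IsLink.false_of_two_le ⟨hx, hp, e1, Or.inr ⟨_, h1, h4.symm, hz⟩⟩
        (by omega) (by omega)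
    · exact IsLink.false_of_two_le ⟨hx, hq, e2, Or.inr ⟨_, h1, h6, hz⟩⟩
        (by omega) (by omega)
    · exact hfc hz hq h
    · exact hfs _ hz h
  · rcases hu' with h | h | rfl | rfl | h | h
    · exact hfs _ hz' h
    · exact hfc hz' hp h
    · exact IsLink.false_of_two_le ⟨hp, hy, e3, Or.inr ⟨_, h4, h3, hz'⟩⟩
        (by omega) (by omega)
    · exact IsLink.false_of_two_le ⟨hy, hq, e4, Or.inr ⟨_, h3.symm, h6, hz'⟩⟩
        (by omega) (by omega)
    · exact hfc hz' hq h
    · exact hfs _ hz' h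
  · rcases hu' with h | h | h | h | h | h
    exacts [hy.ne_s _ h, hy.ne hp e3.symm h, hfc hw hy h.symm, hfc hw' hy h.symm, hy.ne hq e4 h,
      hy.ne_s _ h]
  · rcases hu' with h | h | h | h | h | h
    exacts [e3 h.symm, hp.ne_s _ h.symm, hfs _ hw h.symm, hfs _ hw' h.symm, hq.ne_s _ h.symm, e4 h]

end HubConfiguration

/-! ### Hub configurations from pentagulations -/

namespace SimpleGraph

variable {V : Type*} {G : SimpleGraph V}

theorem not_triangle_of_girth (h : 4 ≤ G.girth) {x y z : V} (hxy : G.Adj x y) (hyz : G.Adj y z)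
    (hzx : G.Adj z x) : False := by
  have hc : (Walk.cons hxy (.cons hyz (.cons hzx .nil))).IsCycle := by
    have := hxy.ne
    have := hyz.ne
    have := hzx.ne
    simp [Walk.isCycle_def, Walk.isTrail_def]
    grind
  have := hc.girth_le_length
  simp at this
  omega

theorem not_square_of_girth (h : 5 ≤ G.girth) {x y z w : V} (hxy : G.Adj x y) (hyz : G.Adj y z)
    (hzw : G.Adj z w) (hwx : G.Adj w x) (hxz : x ≠ z) (hyw : y ≠ w) : False := by
  have hc : (Walk.cons hxy (.cons hyz (.cons hzw (.cons hwx .nil)))).IsCycle := by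
    have := hxy.ne
    have := hyz.ne
    have := hzw.ne
    have := hwx.ne
    simp [Walk.isCycle_def, Walk.isTrail_def]
    grind
  have := hc.girth_le_length
  simp at this
  omega

theorem exists_short_of_diam (hG : G.Connected) (hd : G.diam = 3) (x y : V) :
    x = y ∨ G.Adj x y ∨ (∃ z, G.Adj x z ∧ G.Adj z y) ∨
    ∃ z z', G.Adj x z ∧ G.Adj z z' ∧ G.Adj z' y := by
  obtain ⟨P, hP⟩ := hG.exists_walk_length_eq_dist x y
  have hle : P.length ≤ 3 := by
    rw [hP]
    exact (dist_le_diam (ediam_ne_top_of_diam_ne_zero (by omega))).trans hd.le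
  rcases P with _ | ⟨h1, _ | ⟨h2, _ | ⟨h3, _ | ⟨h4, P⟩⟩⟩⟩
  · exact Or.inl rfl
  · exact Or.inr (Or.inl h1)
  · exact Or.inr (Or.inr (Or.inl ⟨_, h1, h2⟩))
  · exact Or.inr (Or.inr (Or.inr ⟨_, _, h1, h2, h3⟩))
  · simp at hle
    omega

end SimpleGraph

namespace RotationSystem

variable {V : Type*} {G : SimpleGraph V} {R : RotationSystem G}

/-- The two remaining vertices of the face between two consecutive spokes. -/
theorem IsPentagulation.exists_face_path (hR : R.IsPentagulation) (d : G.Dart) (i : ℤ) :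
    ∃ a b, G.Adj (R.spoke d i) a ∧ G.Adj a b ∧ G.Adj (R.spoke d (i + 1)) b ∧ a ≠ d.fst ∧
      b ≠ d.fst := by
  -- Traced from spoke `i + 1`, the face visits `d.fst`, `spoke (i + 1)`, `b`, `a`, `spoke i` in
  -- this order.
  obtain ⟨h5, hinj⟩ := hR.2 ((R.rot ^ (i + 1)) d)
  have hfst := R.rot_zpow_fst (i + 1) d
  have hrot : (R.rot ^ (i + 1)) d = R.rot ((R.rot ^ i) d) := by
    rw [add_comm, zpow_one_add, Equiv.Perm.mul_apply]
  have hsnd : R.spoke d (i + 1) = ((R.rot ^ (i + 1)) d).snd := rfl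
  generalize (R.rot ^ (i + 1)) d = e at *
  have hadj : ∀ m : ℕ, G.Adj ((R.facePerm ^ m) e).fst ((R.facePerm ^ (m + 1)) e).fst := by
    intro m
    rw [pow_succ', Equiv.Perm.mul_apply, R.facePerm_fst]
    exact ((R.facePerm ^ m) e).adj
  -- The fifth step returns to `e`, the rotation successor of spoke `i`, so the last dart of the
  -- face is the reversal of spoke `i`.
  have h4 : ((R.facePerm ^ 4) e).fst = R.spoke d i := by
    have h : R.rot ((R.facePerm ^ 4) e).symm = R.rot ((R.rot ^ i) d) :=
      calc R.rot ((R.facePerm ^ 4) e).symm = R.facePerm ((R.facePerm ^ 4) e) := rfl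
        _ = (R.facePerm ^ 5) e := by rw [pow_succ' _ 4, Equiv.Perm.mul_apply]
        _ = R.rot ((R.rot ^ i) d) := h5.trans hrot
    rw [spoke, ← R.rot.injective h]
    rfl
  have h1 : ((R.facePerm ^ 1) e).fst = R.spoke d (i + 1) := by
    rw [pow_one, R.facePerm_fst, hsnd]
  refine ⟨((R.facePerm ^ 3) e).fst, ((R.facePerm ^ 2) e).fst, h4 ▸ (hadj 3).symm, (hadj 2).symm,
    h1 ▸ hadj 1, fun h => ?_, fun h => ?_⟩
  · have := @hinj 3 0 (h.trans hfst.symm)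
    simp at this
  · have := @hinj 2 0 (h.trans hfst.symm)
    simp at this

/-- In a pentagulation of diameter 3 and girth 5, the faces at a vertex of degree at least 8 form a
hub configuration. -/
theorem IsPentagulation.nonempty_hubConfiguration [Fintype V] [DecidableRel G.Adj]
    (hR : R.IsPentagulation) (hdiam : G.diam = 3) (hgirth : G.girth = 5) (d : G.Dart)
    (hd : 8 ≤ G.degree d.fst) : Nonempty (HubConfiguration G d.fst (G.degree d.fst)) := by
  choose a b hsa hab hsb ha hb using hR.exists_face_path d
  refine ⟨{
    s := R.spoke d
    a := a
    b := b
    eight_le := by exact_mod_cast hd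
    adj_s := R.adj_spoke d
    exists_s_eq := fun u => R.exists_spoke_eq d
    s_eq_iff := R.spoke_eq_spoke_iff d
    adj_sa := hsa
    adj_ab := hab
    adj_sb := hsb
    a_ne := ha
    b_ne := hb
    cross := ?_
    triangle := SimpleGraph.not_triangle_of_girth (by omega)
    square := SimpleGraph.not_square_of_girth (by omega)
    short := SimpleGraph.exists_short_of_diam hR.1.1 hdiam }⟩
  rintro i j k l A B hij hjk hkl hli ⟨P, hP⟩ ⟨Q, hQ⟩ hA hB
  obtain ⟨z, hz, hz'⟩ := hR.1.exists_mem_support_of_spokes_cross d hij hjk hkl hli P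
    (fun h => hA (hP _ h)) Q (fun h => hB (hQ _ h))
  exact ⟨z, hP z hz, hQ z hz'⟩

end RotationSystem

/-- The chord is refuted through its end `x`: as `x` is at distance 2 from `v`, the vertices at
distance 2 from `v` behind four spokes that are at least two apart from each other cannot all be
within distance 3 of each other, because short connections between them would have to cross. -/
theorem mainTheorem10 {V : Type*} [Fintype V] (G : SimpleGraph V) [DecidableRel G.Adj]
    (R : RotationSystem G) (hR : R.IsPentagulation)
    (hdiam : G.diam = 3) (hgirth : G.girth = 5) (hΔ : 8 ≤ G.maxDegree)
    (v : V) (hv : G.degree v = G.maxDegree) :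
    ¬ ∃ (x y : V) (Q : G.Walk x y), R.IsChord v 2 Q := by
  rintro ⟨x, y, Q, -, -, hx, -⟩
  obtain ⟨P, hP⟩ := hR.1.1.exists_walk_length_eq_dist v x
  rw [hx] at hP
  rcases P with _ | ⟨h1, _ | ⟨h2, _ | ⟨h3, P⟩⟩⟩
  · simp at hP
  · simp at hP
  · obtain ⟨H⟩ := hR.nonempty_hubConfiguration hdiam hgirth ⟨(v, _), h1⟩ (by rw [hv]; exact hΔ)
    obtain ⟨i, hi⟩ := H.exists_s_eq _ h1
    refine HubConfiguration.not_child (H := H) (i := i) (x := x) ⟨by rw [hi]; exact h2, ?_⟩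
    rintro rfl
    simp at hx
  · simp at hP
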